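/- Let $(\Omega,\Sigma,\mu)$ be a probability space whose underlying set $\Omega$ is a topological space, let $H$ be a complex Hilbert space (for instance $H=\mathbb{C}^d$), and let $\mathbb{M}^{\mathrm{sa}}$ be the real normed space of bounded self-adjoint operators on $H$ with the operator norm $\|\cdot\|_\infty$. Let $\mathcal{B}$ be the real Banach space of continuous, bounded and $\mu$-Bochner integrable functions $f:\Omega\to\mathbb{M}^{\mathrm{sa}}$ with the uniform norm $|||f|||=\sup_{x\in\Omega}\|f(x)\|_\infty$. (If $\Omega$ is a Polish space with its Borel $\sigma$-algebra, integrability is automatic and $\mathcal{B}$ consists of all bounded continuous functions $\Omega\to\mathbb{M}^{\mathrm{sa}}$.) Write $f\succeq 0$ if $f(x)$ is positive semi-definite for every $x\in\Omega$, and let $I\in\mathcal{B}$ be the constant function equal to the identity operator. A Markov semigroup on $\mathcal{B}$ is a family $(P_t)_{t\ge 0}$ of linear operators $P_t:\mathcal{B}\to\mathcal{B}$ such that (a) $P_0=\mathrm{id}$; (b) for every $f\in\mathcal{B}$ the map $t\mapsto P_tf$ from $[0,\infty)$ to $\mathcal{B}$ is continuous; (c) $P_t\circ P_s=P_{s+t}$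 for all $s,t\ge 0$; (d) $P_tI=I$ for all $t\ge0$; (e) $f\succeq0$ implies $P_tf\succeq 0$ for all $t\ge 0$. Its infinitesimal generator is the operator whose domain is the set of all $f\in\mathcal{B}$ for which the limit $\lim_{t\to0^+}\frac1t(P_tf-f)$ exists in $\mathcal{B}$, and whose value at such an $f$ is this limit. Theorem (Hille–Yosida Theorem for Markov Semigroups). Let $L:D(L)\to\mathcal{B}$ be a linear operator defined on a linear subspace $D(L)\subseteq\mathcal{B}$. Then $L$, with domain $D(L)$, is the infinitesimal generator of some Markov semigroup on $\mathcal{B}$ if and only if all of the following hold: 1. $I\in D(L)$ and $LI=0$; 2. $D(L)$ is dense in $\mathcal{B}$; 3. $L$ is closed, i.e. its graph is closed in $\mathcal{B}\times\mathcal{B}$; 4. for every $\lambda>0$ the operator $\lambda-L:D(L)\to\mathcal{B}$ is invertible (bijective), its inverse $(\lambda-L)^{-1}:\mathcal{B}\to D(L)\subseteq\mathcal{B}$ is bounded with $\sup_{|||f|||\le1}|||(\lambda-L)^{-1}f|||\le\frac1\lambda$, and $(\lambda-L)^{-1}f\succeq0$ for all $f\succeq 0$. -/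

import Mathlib

open MeasureTheory Filter Topology BoundedContinuousFunction
open scoped NNReal

namespace MarkovHY

section
variable {Ω : Type*} [TopologicalSpace Ω] [MeasurableSpace Ω] (μ : Measure Ω)
variable (H : Type*) [NormedAddCommGroup H] [InnerProductSpace ℂ H] [CompleteSpace H]

variable {H} in
theorem isSelfAdjoint_real_smul (c : ℝ) (T : H →L[ℂ] H) (h : IsSelfAdjoint T) :
    IsSelfAdjoint (c • T) := by
  have : c • T = (c : ℂ) • T := by ext x; simp
  rw [this]
  exact IsSelfAdjoint.smul (by simp [IsSelfAdjoint]) h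

/-- The real vector space of continuous, bounded and Bochner integrable functions from `Ω` to the
bounded self-adjoint operators on the complex Hilbert space `H` (for `H = ℂ^d`: to the Hermitian
`d × d` matrices), as a subspace of all bounded continuous operator-valued functions. -/
def bddSubmodule : Submodule ℝ (Ω →ᵇ (H →L[ℂ] H)) where
  carrier := {f | (∀ x, IsSelfAdjoint (f x)) ∧ Integrable (fun x => f x) μ}
  add_mem' := fun hf hg => ⟨fun x => (hf.1 x).add (hg.1 x), hf.2.add hg.2⟩
  zero_mem' := ⟨fun _ => IsSelfAdjoint.zero _, integrable_zero _ _ _⟩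
  smul_mem' := fun c f hf => ⟨fun x => isSelfAdjoint_real_smul c (f x) (hf.1 x),
    show Integrable (c • fun x => f x) μ from hf.2.smul c⟩

/-- The Banach space `𝓑` on which the semigroups act: `bddSubmodule` with the uniform norm
`sup_x ‖f x‖`. -/
def BddSpace : Type _ := bddSubmodule μ H

noncomputable instance : NormedAddCommGroup (BddSpace μ H) :=
  inferInstanceAs (NormedAddCommGroup (bddSubmodule μ H))

noncomputable instance : NormedSpace ℝ (BddSpace μ H) :=
  inferInstanceAs (NormedSpace ℝ (bddSubmodule μ H))

/-- The constant function `x ↦ I`. -/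
noncomputable def idFun [IsFiniteMeasure μ] : BddSpace μ H :=
  ⟨BoundedContinuousFunction.const Ω 1, fun _ => IsSelfAdjoint.one _, integrable_const _⟩

variable {μ H}

/-- `f ≽ 0`: the operator `f x` is positive semi-definite for every `x`. -/
def IsNonneg (f : BddSpace μ H) : Prop :=
  ∀ x : Ω, (f.1 x).IsPositive

/-- Markov semigroups of linear operators on `𝓑`. -/
structure IsMarkovSemigroup [IsFiniteMeasure μ]
    (P : ℝ≥0 → (BddSpace μ H →ₗ[ℝ] BddSpace μ H)) : Prop where
  initial : P 0 = LinearMap.id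
  continuity : ∀ f, Continuous fun t => P t f
  semigroup : ∀ s t, P t ∘ₗ P s = P (s + t)
  mass : ∀ t, P t (idFun μ H) = idFun μ H
  positivity : ∀ t f, IsNonneg f → IsNonneg (P t f)

/-- `L`, with its domain, is the infinitesimal generator of `P`: the domain consists of all `f` for
which `(P_t f - f) / t` converges in `𝓑` as `t → 0+`, and `L f` is the limit. -/
structure IsInfinitesimalGenerator (P : ℝ≥0 → (BddSpace μ H →ₗ[ℝ] BddSpace μ H))
    (L : BddSpace μ H →ₗ.[ℝ] BddSpace μ H) : Prop where
  mem_domain_iff : ∀ f : BddSpace μ H, f ∈ L.domain ↔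
    ∃ g : BddSpace μ H, Tendsto (fun t : ℝ≥0 => (t : ℝ)⁻¹ • (P t f - f)) (𝓝[>] 0) (𝓝 g)
  tendsto : ∀ f : L.domain,
    Tendsto (fun t : ℝ≥0 => (t : ℝ)⁻¹ • (P t (f : BddSpace μ H) - f)) (𝓝[>] 0) (𝓝 (L f))

/-- The bounded operator `R` is the two-sided inverse of `l - L : L.domain → 𝓑`. -/
structure IsResolvent (L : BddSpace μ H →ₗ.[ℝ] BddSpace μ H) (l : ℝ)
    (R : BddSpace μ H →L[ℝ] BddSpace μ H) : Prop where
  right_inv : ∀ g, ∃ h : R g ∈ L.domain, l • R g - L ⟨R g, h⟩ = g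
  left_inv : ∀ f : L.domain, R (l • (f : BddSpace μ H) - L f) = f

end

end MarkovHY

/-! Positivity and `P_t I = I` force contractivity: the order interval `-‖f‖ I ≼ f ≼ ‖f‖ I` is
preserved, and the norm of a self-adjoint operator is read off its quadratic form
(`norm_apply_le_of_isNonneg`). What remains is Hille–Yosida for contraction semigroups that preserve
a cone.

From semigroup to generator: the Laplace transform `∫ e^{-lt} T_t dt` inverts `l - L`, has norm at
most `1 / l` and preserves the cone. Time averages of orbits lie in the domain, which is therefore
dense, and a bounded resolvent makes the graph closed.

From generator to semigroup: the Yosida approximations are bounded and commute, and their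
exponentials are positive contractions. By `norm_exp_sub_exp_le` these exponentials converge. The
generator of the limit extends `L`; since both have a resolvent at `1`, they agree. Finally `‖T_t f
- f‖ ≤ t ‖L f‖` and `L I = 0` give `T_t I = I`. -/

namespace MarkovHY

/-! ### Contraction semigroups, their Laplace transform and generator. -/

section Banach

variable {X : Type*} [NormedAddCommGroup X] [NormedSpace ℝ X]

/-- Strongly continuous semigroups of contractions. -/
structure IsContractionSemigroup (T : ℝ≥0 → X →L[ℝ] X) : Prop where
  zero : ∀ f, T 0 f = f
  add : ∀ s t f, T (s + t) f = T s (T t f)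
  continuous : ∀ f, Continuous fun t => T t f
  norm_le : ∀ t f, ‖T t f‖ ≤ ‖f‖

/-- `g` is the right derivative at `0` of the orbit of `f`. -/
def HasGenerator (T : ℝ≥0 → X →L[ℝ] X) (f g : X) : Prop :=
  Tendsto (fun t : ℝ≥0 => (t : ℝ)⁻¹ • (T t f - f)) (𝓝[>] 0) (𝓝 g)

/-- `R` is the inverse of `l - L`, where `G` is the graph of `L`. -/
structure IsGraphResolvent (G : Set (X × X)) (l : ℝ) (R : X →L[ℝ] X) : Prop where
  mem : ∀ g, (R g, l • R g - g) ∈ G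
  left_inv : ∀ f g, (f, g) ∈ G → R (l • f - g) = f

theorem tendsto_coe_nhdsGT_zero :
    Tendsto (fun t : ℝ≥0 => (t : ℝ)) (𝓝[>] 0) (𝓝[≠] 0) := by
  refine tendsto_nhdsWithin_of_tendsto_nhds_of_eventually_within _
    (tendsto_nhdsWithin_of_tendsto_nhds (by simpa using NNReal.continuous_coe.tendsto 0)) ?_
  filter_upwards [self_mem_nhdsWithin] with t ht
  simpa using (Set.mem_Ioi.1 ht).ne'

/-- The right derivative of an orbit from the derivative of a function on the line. -/
theorem HasGenerator.of_hasDerivAt {T : ℝ≥0 → X →L[ℝ] X} {f g : X} {y : ℝ → X}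
    (hy : ∀ t : ℝ≥0, T t f - f = y t - y 0) (h : HasDerivAt y g 0) : HasGenerator T f g := by
  refine (h.tendsto_slope_zero.comp tendsto_coe_nhdsGT_zero).congr fun t => ?_
  simp [hy]

theorem HasGenerator.unique {T : ℝ≥0 → X →L[ℝ] X} {f g g' : X} (h : HasGenerator T f g)
    (h' : HasGenerator T f g') : g = g' :=
  tendsto_nhds_unique h h'

namespace IsContractionSemigroup

variable {T : ℝ≥0 → X →L[ℝ] X} (hT : IsContractionSemigroup T)
include hT

/-- Freezing the orbit at `f` for negative times keeps it continuous on the line, so two-sided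
calculus applies at `0`. -/
theorem continuous_toNNReal (f : X) : Continuous fun t : ℝ => T t.toNNReal f :=
  (hT.continuous f).comp continuous_real_toNNReal

theorem integrableOn_laplace {l : ℝ} (hl : 0 < l) (f : X) (a : ℝ) :
    IntegrableOn (fun t : ℝ => Real.exp (-l * t) • T t.toNNReal f) (Set.Ioi a) := by
  refine Integrable.mono' ((integrableOn_exp_mul_Ioi (neg_lt_zero.2 hl) a).mul_const ‖f‖) ?_ ?_
  · exact (Continuous.smul (by fun_prop) (hT.continuous_toNNReal f)).aestronglyMeasurable
  · refine ae_of_all _ fun t => ?_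
    rw [norm_smul, Real.norm_of_nonneg (Real.exp_pos _).le]
    exact mul_le_mul_of_nonneg_left (hT.norm_le _ _) (Real.exp_pos _).le

/-- The Laplace transform of the semigroup. -/
noncomputable def laplace {l : ℝ} (hl : 0 < l) : X →L[ℝ] X :=
  LinearMap.mkContinuous
    { toFun := fun f => ∫ t in Set.Ioi (0 : ℝ), Real.exp (-l * t) • T t.toNNReal f
      map_add' := fun f g => by
        simp only [map_add, smul_add]
        exact integral_add (hT.integrableOn_laplace hl f 0) (hT.integrableOn_laplace hl g 0)
      map_smul' := fun c f => by
        simp only [map_smul, smul_comm _ c, RingHom.id_apply]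
        exact integral_smul _ _ }
    (1 / l) fun f => by
      refine (norm_integral_le_of_norm_le
        ((integrableOn_exp_mul_Ioi (neg_lt_zero.2 hl) 0).mul_const ‖f‖)
        (ae_of_all _ fun t => ?_)).trans_eq ?_
      · rw [norm_smul, Real.norm_of_nonneg (Real.exp_pos _).le]
        exact mul_le_mul_of_nonneg_left (hT.norm_le _ _) (Real.exp_pos _).le
      · rw [integral_mul_const, integral_exp_mul_Ioi (neg_lt_zero.2 hl)]
        simp

theorem laplace_apply {l : ℝ} (hl : 0 < l) (f : X) :
    hT.laplace hl f = ∫ t in Set.Ioi (0 : ℝ), Real.exp (-l * t) • T t.toNNReal f := rfl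

theorem norm_laplace_le {l : ℝ} (hl : 0 < l) : ‖hT.laplace hl‖ ≤ 1 / l :=
  LinearMap.mkContinuous_norm_le _ (by positivity) _

variable [CompleteSpace X]

theorem apply_laplace {l : ℝ} (hl : 0 < l) (h : ℝ≥0) (f : X) :
    T h (hT.laplace hl f) = hT.laplace hl (T h f) := by
  rw [laplace_apply, laplace_apply,
    ← ContinuousLinearMap.integral_comp_comm _ (hT.integrableOn_laplace hl f 0)]
  refine integral_congr_ae (ae_of_all _ fun t => ?_)
  simp only [map_smul]
  rw [← hT.add, ← hT.add, add_comm]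

/-- The substitution `t ↦ t + h` moves all dependence on `h` into a scalar and an endpoint of
integration, so no orbit has to be differentiated. -/
theorem apply_laplace_eq {l : ℝ} (hl : 0 < l) (h : ℝ≥0) (f : X) :
    T h (hT.laplace hl f) = Real.exp (l * h) • (hT.laplace hl f -
      ∫ t in (0 : ℝ)..h, Real.exp (-l * t) • T t.toNNReal f) := by
  have h1 : T h (hT.laplace hl f) = ∫ t in Set.Ioi (0 : ℝ), Real.exp (l * h) •
      (Real.exp (-l * (t + h)) • T (t + h).toNNReal f) := by
    rw [laplace_apply,
      ← ContinuousLinearMap.integral_comp_comm _ (hT.integrableOn_laplace hl f 0)]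
    refine setIntegral_congr_fun measurableSet_Ioi fun t ht => ?_
    have ht' : (0 : ℝ) ≤ t := (Set.mem_Ioi.1 ht).le
    simp only [map_smul]
    rw [Real.toNNReal_add ht' h.coe_nonneg, Real.toNNReal_coe, add_comm _ h, hT.add, smul_smul,
      ← Real.exp_add]
    congr 2
    ring
  have h2 := (measurePreserving_add_right volume (h : ℝ)).setIntegral_preimage_emb
    (measurableEmbedding_addRight (h : ℝ))
    (fun t : ℝ => Real.exp (-l * t) • T t.toNNReal f) (Set.Ioi (h : ℝ))
  have h3 : (fun t : ℝ => t + h) ⁻¹' Set.Ioi (h : ℝ) = Set.Ioi 0 := by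
    ext t; simp
  rw [h3] at h2
  rw [h1, integral_smul, h2, laplace_apply, ← intervalIntegral.integral_interval_add_Ioi
    (hT.integrableOn_laplace hl f 0) (hT.integrableOn_laplace hl f h), add_sub_cancel_left]

theorem hasGenerator_laplace {l : ℝ} (hl : 0 < l) (f : X) :
    HasGenerator T (hT.laplace hl f) (l • hT.laplace hl f - f) := by
  refine HasGenerator.of_hasDerivAt (y := fun h : ℝ => Real.exp (l * h) • (hT.laplace hl f -
      ∫ t in (0 : ℝ)..h, Real.exp (-l * t) • T t.toNNReal f))
    (fun t => by rw [hT.apply_laplace_eq]; simp) ?_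
  have hc : Continuous fun t : ℝ => Real.exp (-l * t) • T t.toNNReal f :=
    Continuous.smul (by fun_prop) (hT.continuous_toNNReal f)
  have h1 : HasDerivAt (fun h : ℝ => Real.exp (l * h)) l 0 := by
    simpa using ((hasDerivAt_id (0 : ℝ)).const_mul l).exp
  have h2 := ((hc.integral_hasStrictDerivAt 0 0).hasDerivAt).const_sub (hT.laplace hl f)
  refine (h1.smul h2).congr_deriv ?_
  simp [hT.zero]
  abel

theorem isGraphResolvent_laplace {l : ℝ} (hl : 0 < l) :
    IsGraphResolvent {p | HasGenerator T p.1 p.2} l (hT.laplace hl) where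
  mem := hT.hasGenerator_laplace hl
  left_inv f g h := by
    -- The transform commutes with `T`, hence maps difference quotients of `f` to those of its
    -- image; uniqueness of the limit then gives the identity.
    have h1 : HasGenerator T (hT.laplace hl f) (hT.laplace hl g) := by
      refine (((hT.laplace hl).continuous.tendsto g).comp h).congr fun t => ?_
      simp [hT.apply_laplace]
    rw [map_sub, map_smul, h1.unique (hT.hasGenerator_laplace hl f)]
    abel

theorem dense_hasGenerator : Dense {f : X | ∃ g, HasGenerator T f g} := by
  intro f
  set y : ℝ → X := fun t => ∫ s in (0 : ℝ)..t, T s.toNNReal f with hy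
  have hc := hT.continuous_toNNReal f
  have hi (a b : ℝ) : IntervalIntegrable (fun s : ℝ => T s.toNNReal f) volume a b :=
    hc.intervalIntegrable a b
  have hd (t : ℝ) : HasDerivAt y (T t.toNNReal f) t := (hc.integral_hasStrictDerivAt 0 t).hasDerivAt
  have hy0 : y 0 = 0 := by simp [hy]
  have hlim : Tendsto (fun t : ℝ≥0 => (t : ℝ)⁻¹ • y t) (𝓝[>] 0) (𝓝 f) := by
    have := (hd 0).tendsto_slope_zero.comp tendsto_coe_nhdsGT_zero
    simpa [hT.zero, hy0, Function.comp_def] using this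
  refine mem_closure_of_tendsto hlim (Eventually.of_forall fun t => ?_)
  have hg : HasGenerator T (y t) (T t f - f) := by
    -- `T h` shifts the interval of integration from `[0, t]` to `[h, t + h]`.
    refine HasGenerator.of_hasDerivAt (y := fun h : ℝ => y (t + h) - y h) (fun h => ?_) ?_
    · have h1 : T h (y t) = ∫ s in (0 : ℝ)..t, T (s + h).toNNReal f := by
        rw [hy]
        simp only
        rw [← ContinuousLinearMap.intervalIntegral_comp_comm _ (hi _ _)]
        refine intervalIntegral.integral_congr fun s hs => ?_
        rw [Set.uIcc_of_le t.coe_nonneg] at hs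
        rw [Real.toNNReal_add hs.1 h.coe_nonneg, Real.toNNReal_coe, add_comm _ h, hT.add]
      rw [h1, intervalIntegral.integral_comp_add_right (fun s : ℝ => T s.toNNReal f), zero_add,
        ← intervalIntegral.integral_interval_sub_left (hi 0 _) (hi 0 _)]
      simp [hy]
    · have h1 := ((hd (t + 0)).comp_const_add (t : ℝ) 0).sub (hd 0)
      exact h1.congr_deriv (by simp [hT.zero])
  refine ⟨(t : ℝ)⁻¹ • (T t f - f), ?_⟩
  refine (Tendsto.const_smul hg (t : ℝ)⁻¹).congr fun s => ?_
  rw [map_smul, ← smul_sub, smul_comm]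

end IsContractionSemigroup

end Banach

/-! ### Resolvents and the Yosida approximation. -/

section Yosida

variable {X : Type*} [NormedAddCommGroup X] [NormedSpace ℝ X]

/-- The resolvent identity, obtained by applying the left inverse `R` to the graph point that `S`
produces from `g`. -/
theorem IsGraphResolvent.sub_eq {G : Set (X × X)} {l m : ℝ} {R S : X →L[ℝ] X}
    (hR : IsGraphResolvent G l R) (hS : IsGraphResolvent G m S) (g : X) :
    S g - R g = (l - m) • R (S g) := by
  have h := hR.left_inv _ _ (hS.mem g)
  rw [← map_smul, sub_eq_iff_eq_add, ← map_add]
  conv_lhs => rw [← h]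
  congr 1
  rw [sub_smul]
  abel

theorem IsGraphResolvent.unique {G : Set (X × X)} {l : ℝ} {R S : X →L[ℝ] X}
    (hR : IsGraphResolvent G l R) (hS : IsGraphResolvent G l S) : R = S := by
  ext g
  have := hR.sub_eq hS g
  rw [sub_self, zero_smul, sub_eq_zero] at this
  exact this.symm

theorem IsGraphResolvent.commute {G : Set (X × X)} {l m : ℝ} {R S : X →L[ℝ] X}
    (hR : IsGraphResolvent G l R) (hS : IsGraphResolvent G m S) : Commute R S := by
  rcases eq_or_ne l m with rfl | hlm
  · rw [hR.unique hS]
  · ext g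
    have h1 := hR.sub_eq hS g
    have h2 := hS.sub_eq hR g
    have h3 : (l - m) • (R (S g) - S (R g)) = 0 := by
      rw [smul_sub, ← h1, ← neg_sub m l, neg_smul, ← h2]
      abel
    exact sub_eq_zero.1 ((smul_eq_zero.1 h3).resolve_left (sub_ne_zero.2 hlm))

theorem IsGraphResolvent.isClosed {G : Set (X × X)} {l : ℝ} {R : X →L[ℝ] X}
    (hR : IsGraphResolvent G l R) : IsClosed G := by
  have : G = {p | R (l • p.1 - p.2) = p.1} := by
    ext ⟨f, g⟩
    refine ⟨hR.left_inv f g, fun h => ?_⟩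
    have h1 : R (l • f - g) = f := h
    simpa [h1] using hR.mem (l • f - g)
  rw [this]
  exact isClosed_eq (by fun_prop) (by fun_prop)

/-- A graph with a resolvent has no proper extension with a resolvent at the same point. -/
theorem IsGraphResolvent.eq_of_subset {G G' : Set (X × X)} {l : ℝ} {R S : X →L[ℝ] X}
    (hR : IsGraphResolvent G l R) (hS : IsGraphResolvent G' l S) (h : G ⊆ G') : G = G' := by
  refine h.antisymm ?_
  rintro ⟨f, g⟩ hfg
  -- `S` recovers both `R (l • f - g)` and `f` from the same vector `l • f - g`, so they coincide.
  have h1 := hS.left_inv _ _ (h (hR.mem (l • f - g)))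
  have h2 := hS.left_inv _ _ hfg
  rw [sub_sub_cancel, h2] at h1
  simpa [← h1] using hR.mem (l • f - g)

theorem tendsto_of_tendsto_on_dense {A : ℕ → X →L[ℝ] X} {B : X →L[ℝ] X} {C : ℝ}
    (hA : ∀ n, ‖A n‖ ≤ C) {D : Set X} (hD : Dense D)
    (h : ∀ f ∈ D, Tendsto (fun n => A n f) atTop (𝓝 (B f))) (f : X) :
    Tendsto (fun n => A n f) atTop (𝓝 (B f)) := by
  have hC : 0 ≤ C := (norm_nonneg _).trans (hA 0)
  rw [Metric.tendsto_atTop]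
  intro ε hε
  have hM : 0 < C + ‖B‖ + 1 := by positivity
  obtain ⟨g, hg, hfg⟩ := hD.exists_dist_lt f (ε := ε / 2 / (C + ‖B‖ + 1)) (by positivity)
  obtain ⟨N, hN⟩ := Metric.tendsto_atTop.1 (h g hg) (ε / 2) (half_pos hε)
  refine ⟨N, fun n hn => ?_⟩
  have h1 := hN n hn
  rw [dist_eq_norm] at h1 hfg ⊢
  have h2 : A n f - B f = A n (f - g) + (A n g - B g) - B (f - g) := by
    simp only [map_sub]; abel
  have h3 : ‖A n (f - g)‖ ≤ C * ‖f - g‖ := (A n).le_of_opNorm_le (hA n) _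
  have h4 : ‖B (f - g)‖ ≤ ‖B‖ * ‖f - g‖ := B.le_opNorm _
  have h5 : (C + ‖B‖ + 1) * ‖f - g‖ < ε / 2 := by
    rwa [lt_div_iff₀ hM, mul_comm] at hfg
  calc ‖A n f - B f‖ ≤ ‖A n (f - g)‖ + ‖A n g - B g‖ + ‖B (f - g)‖ := by
        rw [h2]; exact (norm_sub_le _ _).trans (by gcongr; exact norm_add_le _ _)
    _ < ε := by nlinarith [norm_nonneg (f - g)]

/-- The Yosida approximation `l² (l - L)⁻¹ - l`. -/
def yosida (l : ℝ) (R : X →L[ℝ] X) : X →L[ℝ] X := l ^ 2 • R - l • 1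

theorem yosida_apply_of_mem {G : Set (X × X)} {l : ℝ} {R : X →L[ℝ] X}
    (hR : IsGraphResolvent G l R) {f g : X} (h : (f, g) ∈ G) : yosida l R f = l • R g := by
  have h1 := hR.left_inv f g h
  rw [map_sub, map_smul, sub_eq_iff_eq_add] at h1
  simp only [yosida, _root_.sub_apply, _root_.smul_apply,
    one_apply_eq_self]
  rw [pow_two, mul_smul, h1, smul_add]
  abel

theorem commute_yosida {l m : ℝ} {R S : X →L[ℝ] X} (h : Commute R S) :
    Commute (yosida l R) (yosida m S) := by
  unfold yosida
  refine Commute.sub_left (Commute.sub_right ?_ ?_) (Commute.sub_right ?_ ?_)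
  · exact (h.smul_left _).smul_right _
  · exact ((Commute.one_right _).smul_left _).smul_right _
  · exact ((Commute.one_left _).smul_left _).smul_right _
  · exact ((Commute.one_left _).smul_left _).smul_right _

section Resolvents

variable {G : Set (X × X)} {R : ℕ → X →L[ℝ] X}
  (hR : ∀ n : ℕ, IsGraphResolvent G (n + 1) (R n)) (hn : ∀ n : ℕ, ‖R n‖ ≤ 1 / (n + 1))
include hR hn

/-- For `(f, g)` in the graph the error is exactly `R n g = O(1 / n)`; uniform contractivity extends
the limit to all `f`. -/
theorem tendsto_smul_resolvent (hD : Dense {f | ∃ g, (f, g) ∈ G}) (f : X) :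
    Tendsto (fun n : ℕ => ((n : ℝ) + 1) • R n f) atTop (𝓝 f) := by
  refine tendsto_of_tendsto_on_dense (A := fun n : ℕ => ((n : ℝ) + 1) • R n) (B := 1) (C := 1)
    (fun n => ?_) hD ?_ f
  · have hp : (0 : ℝ) < n + 1 := by positivity
    rw [norm_smul, Real.norm_of_nonneg hp.le]
    exact (mul_le_mul_of_nonneg_left (hn n) hp.le).trans_eq (by field_simp)
  · rintro f ⟨g, hfg⟩
    rw [tendsto_iff_norm_sub_tendsto_zero]
    have h0 : Tendsto (fun n : ℕ => 1 / ((n : ℝ) + 1) * ‖g‖) atTop (𝓝 0) := by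
      simpa using tendsto_one_div_add_atTop_nhds_zero_nat.mul_const ‖g‖
    refine squeeze_zero (fun _ => norm_nonneg _) (fun n => ?_) h0
    have h1 := (hR n).left_inv f g hfg
    have h2 : (((n : ℝ) + 1) • R n) f - (1 : X →L[ℝ] X) f = R n g := by
      rw [map_sub, map_smul, sub_eq_iff_eq_add] at h1
      simp only [_root_.smul_apply, one_apply_eq_self]
      rw [h1, add_sub_cancel_left]
    rw [h2]
    exact (R n).le_of_opNorm_le (hn n) g

theorem tendsto_yosida (hD : Dense {f | ∃ g, (f, g) ∈ G}) {f g : X} (h : (f, g) ∈ G) :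
    Tendsto (fun n : ℕ => yosida ((n : ℝ) + 1) (R n) f) atTop (𝓝 g) :=
  (tendsto_smul_resolvent hR hn hD g).congr fun n => (yosida_apply_of_mem (hR n) h).symm

end Resolvents

/-! ### Exponentials of bounded operators and generation of semigroups. -/

variable [CompleteSpace X]

theorem exp_add_of_commute {A B : X →L[ℝ] X} (h : Commute A B) :
    NormedSpace.exp (A + B) = NormedSpace.exp A * NormedSpace.exp B :=
  let _ : NormedAlgebra ℚ (X →L[ℝ] X) := NormedAlgebra.restrictScalars ℚ ℝ _
  NormedSpace.exp_add_of_commute h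

/-- With the scalar part split off, for `t ≥ 0` the exponent left is a nonnegative multiple of `R`:
contractivity and positivity both follow from those of `R`. -/
theorem exp_smul_yosida (t l : ℝ) (R : X →L[ℝ] X) :
    NormedSpace.exp (t • yosida l R) = Real.exp (-(t * l)) • NormedSpace.exp ((t * l ^ 2) • R) := by
  have h1 : t • yosida l R = (t * l ^ 2) • R + algebraMap ℝ (X →L[ℝ] X) (-(t * l)) := by
    rw [yosida, smul_sub, smul_smul, smul_smul, Algebra.algebraMap_eq_smul_one, neg_smul,
      sub_eq_add_neg]
  rw [h1, exp_add_of_commute (Algebra.commute_algebraMap_right _ _), ← NormedSpace.algebraMap_exp_comm,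
    ← Real.exp_eq_exp_ℝ, ← Algebra.commutes, ← Algebra.smul_def]

theorem norm_exp_le (A : X →L[ℝ] X) : ‖NormedSpace.exp A‖ ≤ Real.exp ‖A‖ := by
  have h2 := NormedSpace.exp_series_hasSum_exp' (𝕂 := ℝ) ‖A‖
  rw [← Real.exp_eq_exp_ℝ] at h2
  refine (NormedSpace.exp_series_hasSum_exp' (𝕂 := ℝ) A).norm_le_of_bounded h2 fun n => ?_
  rw [norm_smul, Real.norm_of_nonneg (by positivity), smul_eq_mul]
  gcongr
  cases n with
  | zero => rw [pow_zero, pow_zero]; exact ContinuousLinearMap.norm_id_le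
  | succ n => exact norm_pow_le' A n.succ_pos

theorem norm_exp_smul_yosida_le {t l : ℝ} (ht : 0 ≤ t) (hl : 0 < l) {R : X →L[ℝ] X}
    (hR : ‖R‖ ≤ 1 / l) : ‖NormedSpace.exp (t • yosida l R)‖ ≤ 1 := by
  rw [exp_smul_yosida, norm_smul, Real.norm_of_nonneg (Real.exp_pos _).le]
  have h1 : ‖(t * l ^ 2) • R‖ ≤ t * l := by
    rw [norm_smul, Real.norm_of_nonneg (by positivity)]
    exact (mul_le_mul_of_nonneg_left hR (by positivity)).trans_eq (by field_simp)
  calc _ ≤ Real.exp (-(t * l)) * Real.exp (t * l) := by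
        gcongr
        exact (norm_exp_le _).trans (Real.exp_le_exp.2 h1)
    _ = 1 := by rw [← Real.exp_add]; simp

/-- If `A` preserves the cone on which the functionals `φ i` are nonnegative, so does `exp A`. -/
theorem exp_nonneg {ι : Type*} (φ : ι → X →L[ℝ] ℝ) {A : X →L[ℝ] X}
    (hA : ∀ f, (∀ i, 0 ≤ φ i f) → ∀ i, 0 ≤ φ i (A f)) {f : X} (hf : ∀ i, 0 ≤ φ i f) (i : ι) :
    0 ≤ φ i (NormedSpace.exp A f) := by
  have h1 := NormedSpace.exp_series_hasSum_exp' (𝕂 := ℝ) A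
  have h2 := (h1.mapL (ContinuousLinearMap.apply ℝ X f)).mapL (φ i)
  refine h2.nonneg fun n => ?_
  have h3 : ∀ i, 0 ≤ φ i ((A ^ n) f) := by
    induction n with
    | zero => simpa using hf
    | succ n ih => rw [pow_succ']; exact hA _ ih
  simpa using mul_nonneg (by positivity) (h3 i)

/-- The path `exp ((t - s) B) exp (s A)`, `0 ≤ s ≤ t`, joins the two exponentials through
contractions, and its derivative at `f` is the same product applied to `(A - B) f`. -/
theorem norm_exp_sub_exp_le {A B : X →L[ℝ] X} (h : Commute A B)
    (hA : ∀ t : ℝ, 0 ≤ t → ‖NormedSpace.exp (t • A)‖ ≤ 1)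
    (hB : ∀ t : ℝ, 0 ≤ t → ‖NormedSpace.exp (t • B)‖ ≤ 1) {t : ℝ} (ht : 0 ≤ t) (f : X) :
    ‖NormedSpace.exp (t • A) f - NormedSpace.exp (t • B) f‖ ≤ t * ‖A f - B f‖ := by
  have hBC : Commute B (A - B) := h.symm.sub_right (Commute.refl B)
  -- The left side is easy to differentiate in `s`; the right side is visibly a contraction.
  have hsplit (s : ℝ) : NormedSpace.exp (t • B) * NormedSpace.exp (s • (A - B)) =
      NormedSpace.exp ((t - s) • B) * NormedSpace.exp (s • A) := by
    rw [← exp_add_of_commute ((hBC.smul_left _).smul_right _),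
      ← exp_add_of_commute ((h.symm.smul_left _).smul_right _)]
    congr 1
    rw [smul_sub, sub_smul]
    abel
  have hder (s : ℝ) : HasDerivAt (fun s : ℝ => NormedSpace.exp (t • B)
      (NormedSpace.exp (s • (A - B)) f))
      (NormedSpace.exp (t • B) (NormedSpace.exp (s • (A - B)) ((A - B) f))) s :=
    ((NormedSpace.exp (t • B)).hasFDerivAt.comp_hasDerivAt s
      ((ContinuousLinearMap.apply ℝ X f).hasFDerivAt.comp_hasDerivAt s
        (hasDerivAt_exp_smul_const (A - B) s)))
  have hb : ∀ s ∈ Set.Ico (0 : ℝ) t,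
      ‖NormedSpace.exp (t • B) (NormedSpace.exp (s • (A - B)) ((A - B) f))‖ ≤ ‖A f - B f‖ := by
    intro s hs
    have h1 := congrArg (fun S : X →L[ℝ] X => S ((A - B) f)) (hsplit s)
    simp only [mul_apply_eq_comp] at h1
    rw [h1]
    calc _ ≤ 1 * (1 * ‖(A - B) f‖) :=
          (ContinuousLinearMap.le_of_opNorm_le _ (hB _ (sub_nonneg.2 hs.2.le)) _).trans
            (mul_le_mul_of_nonneg_left (ContinuousLinearMap.le_of_opNorm_le _ (hA _ hs.1) _)
              zero_le_one)
      _ = _ := by simp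
  have := norm_image_sub_le_of_norm_deriv_le_segment'
    (fun s _ => (hder s).hasDerivWithinAt) hb t (Set.right_mem_Icc.2 ht)
  have h1 := congrArg (fun S : X →L[ℝ] X => S f) (hsplit t)
  simp only [mul_apply_eq_comp, sub_self, zero_smul, NormedSpace.exp_zero,
    one_apply_eq_self] at h1
  rw [h1] at this
  simpa [mul_comm] using this

/-- The limit of commuting contraction semigroups with bounded generators that converge on a dense
set. -/
theorem exists_semigroup_of_tendsto {A : ℕ → X →L[ℝ] X} (hcomm : ∀ m n, Commute (A m) (A n))
    (hA : ∀ n (t : ℝ), 0 ≤ t → ‖NormedSpace.exp (t • A n)‖ ≤ 1) {G : Set (X × X)}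
    (hD : Dense {f | ∃ g, (f, g) ∈ G})
    (hG : ∀ f g, (f, g) ∈ G → Tendsto (fun n => A n f) atTop (𝓝 g)) :
    ∃ T : ℝ≥0 → X →L[ℝ] X, IsContractionSemigroup T ∧
      (∀ (t : ℝ≥0) f, Tendsto (fun n => NormedSpace.exp ((t : ℝ) • A n) f) atTop (𝓝 (T t f))) ∧
      ∀ f g, (f, g) ∈ G → HasGenerator T f g ∧ ∀ t : ℝ≥0, ‖T t f - f‖ ≤ t * ‖g‖ := by
  have hle (n : ℕ) (t : ℝ≥0) (f : X) : ‖NormedSpace.exp ((t : ℝ) • A n) f‖ ≤ ‖f‖ := by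
    simpa using ContinuousLinearMap.le_of_opNorm_le _ (hA n t t.2) f
  have hdiff (m n : ℕ) (t : ℝ≥0) (f : X) : ‖NormedSpace.exp ((t : ℝ) • A m) f -
      NormedSpace.exp ((t : ℝ) • A n) f‖ ≤ t * ‖A m f - A n f‖ :=
    norm_exp_sub_exp_le (hcomm m n) (hA m) (hA n) t.2 f
  have hlim (t : ℝ≥0) (f : X) :
      ∃ g, Tendsto (fun n => NormedSpace.exp ((t : ℝ) • A n) f) atTop (𝓝 g) := by
    refine cauchySeq_tendsto_of_complete (Metric.cauchySeq_iff.2 fun ε hε => ?_)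
    obtain ⟨f', ⟨g, hfg⟩, hff⟩ := hD.exists_dist_lt f (ε := ε / 4) (by positivity)
    obtain ⟨N, hN⟩ := Metric.cauchySeq_iff.1 (hG f' g hfg).cauchySeq (ε / 4 / (t + 1))
      (by positivity)
    refine ⟨N, fun m hm n hn => ?_⟩
    have h1 := hN m hm n hn
    rw [dist_eq_norm] at h1 hff ⊢
    rw [lt_div_iff₀ (by positivity)] at h1
    have h2 : NormedSpace.exp ((t : ℝ) • A m) f - NormedSpace.exp ((t : ℝ) • A n) f =
        NormedSpace.exp ((t : ℝ) • A m) (f - f') + (NormedSpace.exp ((t : ℝ) • A m) f' -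
        NormedSpace.exp ((t : ℝ) • A n) f') - NormedSpace.exp ((t : ℝ) • A n) (f - f') := by
      simp only [map_sub]; abel
    calc _ ≤ ‖f - f'‖ + t * ‖A m f' - A n f'‖ + ‖f - f'‖ := by
          rw [h2]
          refine (norm_sub_le _ _).trans (add_le_add ((norm_add_le _ _).trans
            (add_le_add (hle _ _ _) (hdiff _ _ _ _))) (hle _ _ _))
      _ < ε := by nlinarith [norm_nonneg (A m f' - A n f')]
  choose T hT using hlim
  have hTle (t : ℝ≥0) (f : X) : ‖T t f‖ ≤ ‖f‖ :=
    le_of_tendsto' (hT t f).norm fun n => hle n t f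
  let T' (t : ℝ≥0) : X →L[ℝ] X := LinearMap.mkContinuous
    { toFun := T t
      map_add' := fun f g => tendsto_nhds_unique (hT t (f + g))
        (by simpa using (hT t f).add (hT t g))
      map_smul' := fun c f => tendsto_nhds_unique (hT t (c • f))
        (by simpa using (hT t f).const_smul c) } 1 (by simpa using hTle t)
  -- The error is linear in `t`, so after division by `t` it is small uniformly in `t`. This permits
  -- fixing `n` before letting `t → 0` when the generator is computed.
  have hclose {f g : X} (hfg : (f, g) ∈ G) (n : ℕ) (t : ℝ≥0) :
      ‖NormedSpace.exp ((t : ℝ) • A n) f - T t f‖ ≤ t * ‖A n f - g‖ :=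
    le_of_tendsto_of_tendsto' ((hT t f).const_sub _).norm
      (((hG f g hfg).const_sub _).norm.const_mul _) fun m => hdiff n m t f
  have hadd (s t : ℝ≥0) (f : X) : T (s + t) f = T s (T t f) := by
    have h1 : Tendsto (fun n => NormedSpace.exp ((s : ℝ) • A n)
        (NormedSpace.exp ((t : ℝ) • A n) f)) atTop (𝓝 (T s (T t f))) := by
      have h2 : Tendsto (fun n => NormedSpace.exp ((s : ℝ) • A n)
          (NormedSpace.exp ((t : ℝ) • A n) f - T t f)) atTop (𝓝 0) :=
        squeeze_zero_norm (fun n => hle _ _ _) (by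
          simpa using ((hT t f).sub_const (T t f)).norm)
      simpa using h2.add (hT s (T t f))
    refine tendsto_nhds_unique (hT (s + t) f) (h1.congr fun n => ?_)
    rw [NNReal.coe_add, add_smul,
      exp_add_of_commute (((Commute.refl _).smul_left _).smul_right _)]
    rfl
  have hzero (f : X) : T 0 f = f := by
    refine tendsto_nhds_unique (hT 0 f) ?_
    simp
  have hinc {f g : X} (hfg : (f, g) ∈ G) (t : ℝ≥0) : ‖T t f - f‖ ≤ t * ‖g‖ := by
    refine le_of_tendsto_of_tendsto' ((hT t f).sub_const f).norm
      ((hG f g hfg).norm.const_mul (t : ℝ)) fun n => ?_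
    -- Comparison with the constant semigroup.
    have h1 := norm_exp_sub_exp_le (A := A n) (B := 0) (Commute.zero_right _) (hA n)
      (fun s _ => by rw [smul_zero, NormedSpace.exp_zero]; exact ContinuousLinearMap.norm_id_le) t.2 f
    simpa using h1
  have hlip {f g : X} (hfg : (f, g) ∈ G) (s t : ℝ≥0) : dist (T s f) (T t f) ≤ ‖g‖ * dist s t := by
    wlog hst : s ≤ t generalizing s t
    · rw [dist_comm, dist_comm s]
      exact this t s (le_of_not_ge hst)
    obtain ⟨r, rfl⟩ := exists_add_of_le hst
    rw [dist_comm, dist_eq_norm, hadd]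
    have h1 : ‖T' s (T r f - f)‖ ≤ ‖T r f - f‖ := hTle _ _
    rw [map_sub] at h1
    refine h1.trans ((hinc hfg r).trans_eq ?_)
    rw [NNReal.dist_eq, mul_comm]
    simp
  refine ⟨T', ⟨hzero, hadd, fun f => ?_, hTle⟩, hT, fun f g hfg => ⟨?_, hinc hfg⟩⟩
  · refine continuous_iff_continuousAt.2 fun t => Metric.tendsto_nhds.2 fun ε hε => ?_
    obtain ⟨f', ⟨g, hfg⟩, hff⟩ := hD.exists_dist_lt f (ε := ε / 3) (by positivity)
    have hc : Continuous fun t => T t f' :=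
      (LipschitzWith.of_dist_le_mul (K := ‖g‖₊) (hlip hfg)).continuous
    filter_upwards [Metric.tendsto_nhds.1 (hc.tendsto t) (ε / 3) (by positivity)] with s hs
    have hd (r : ℝ≥0) : dist (T r f) (T r f') ≤ dist f f' := by
      rw [dist_eq_norm, dist_eq_norm]
      have h1 : ‖T' r (f - f')‖ ≤ ‖f - f'‖ := hTle _ _
      rwa [map_sub] at h1
    have h1 := hd s
    have h2 := hd t
    rw [dist_comm] at h2
    have h3 := dist_triangle4 (T s f) (T s f') (T t f') (T t f)
    change dist (T s f) (T t f) < ε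
    linarith
  · refine Metric.tendsto_nhds.2 fun ε hε => ?_
    obtain ⟨n, hn⟩ := (Metric.tendsto_nhds.1 (hG f g hfg) (ε / 3) (by positivity)).exists
    have hder : HasDerivAt (fun t : ℝ => NormedSpace.exp (t • A n) f) (A n f) 0 := by
      have := (ContinuousLinearMap.apply ℝ X f).hasFDerivAt.comp_hasDerivAt (0 : ℝ)
        (hasDerivAt_exp_smul_const (A n) (0 : ℝ))
      simpa [Function.comp_def] using this
    have h1 := Metric.tendsto_nhds.1 (hder.tendsto_slope_zero.comp tendsto_coe_nhdsGT_zero)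
      (ε / 3) (by positivity)
    filter_upwards [h1, self_mem_nhdsWithin] with t ht ht0
    have ht0' : (0 : ℝ) < t := ht0
    have h2 := hclose hfg n t
    rw [dist_eq_norm] at ht hn ⊢
    simp only [Function.comp_apply, zero_add, zero_smul, NormedSpace.exp_zero,
      one_apply_eq_self] at ht
    have h3 : ‖(t : ℝ)⁻¹ • (NormedSpace.exp ((t : ℝ) • A n) f - T t f)‖ ≤ ‖A n f - g‖ := by
      rw [norm_smul, norm_inv, Real.norm_of_nonneg ht0'.le, inv_mul_le_iff₀ ht0']
      exact h2
    have h4 : (t : ℝ)⁻¹ • (T t f - f) - g = ((t : ℝ)⁻¹ • (NormedSpace.exp ((t : ℝ) • A n) f - f) -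
        A n f) - (t : ℝ)⁻¹ • (NormedSpace.exp ((t : ℝ) • A n) f - T t f) + (A n f - g) := by
      simp only [smul_sub]; abel
    calc ‖(t : ℝ)⁻¹ • (T t f - f) - g‖ ≤
          ‖(t : ℝ)⁻¹ • (NormedSpace.exp ((t : ℝ) • A n) f - f) - A n f‖ +
          ‖(t : ℝ)⁻¹ • (NormedSpace.exp ((t : ℝ) • A n) f - T t f)‖ + ‖A n f - g‖ := by
          rw [h4]; exact (norm_add_le _ _).trans (by gcongr; exact norm_sub_le _ _)
      _ < ε := by linarith

/-- The Hille–Yosida theorem for contraction semigroups, generation part, with invariance of the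
cone defined by a family of functionals. -/
theorem exists_semigroup_of_resolvent {ι : Type*} (φ : ι → X →L[ℝ] ℝ) {G : Set (X × X)}
    (hD : Dense {f | ∃ g, (f, g) ∈ G})
    (hG : ∀ l : ℝ, 0 < l → ∃ R : X →L[ℝ] X, IsGraphResolvent G l R ∧ ‖R‖ ≤ 1 / l ∧
      ∀ f, (∀ i, 0 ≤ φ i f) → ∀ i, 0 ≤ φ i (R f)) :
    ∃ T : ℝ≥0 → X →L[ℝ] X, IsContractionSemigroup T ∧
      (∀ t f, (∀ i, 0 ≤ φ i f) → ∀ i, 0 ≤ φ i (T t f)) ∧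
      (∀ f g, (f, g) ∈ G → ∀ t : ℝ≥0, ‖T t f - f‖ ≤ t * ‖g‖) ∧
      {p | HasGenerator T p.1 p.2} = G := by
  have hG' (n : ℕ) := hG (n + 1) (by positivity)
  choose R hR hn hpos using hG'
  obtain ⟨T, hT, hlim, hgen⟩ := exists_semigroup_of_tendsto
    (A := fun n : ℕ => yosida ((n : ℝ) + 1) (R n)) (G := G)
    (fun m n => commute_yosida ((hR m).commute (hR n)))
    (fun n t ht => norm_exp_smul_yosida_le ht (by positivity) (hn n)) hD
    (fun f g h => tendsto_yosida hR hn hD h)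
  refine ⟨T, hT, fun t f hf i => ?_, fun f g h => (hgen f g h).2, ?_⟩
  · refine ge_of_tendsto' (((φ i).continuous.tendsto _).comp (hlim t f)) fun n => ?_
    have h1 := exp_nonneg φ (A := ((t : ℝ) * ((n : ℝ) + 1) ^ 2) • R n)
      (fun f hf i => by
        simpa using mul_nonneg (by positivity) (hpos n f hf i)) hf i
    simp only [Function.comp_apply, exp_smul_yosida, _root_.smul_apply, map_smul]
    exact mul_nonneg (Real.exp_pos _).le h1
  -- `R 0` is the resolvent at `0 + 1`, compared with the Laplace transform at the same point.
  · exact ((hR 0).eq_of_subset (hT.isGraphResolvent_laplace (by positivity))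
      fun p hp => (hgen p.1 p.2 hp).1).symm

end Yosida

/-! ### The space `𝓑`, its positive cone and its norm. -/

section Bdd

variable {Ω : Type*} [TopologicalSpace Ω] [MeasurableSpace Ω] {μ : Measure Ω}
variable {H : Type*} [NormedAddCommGroup H] [InnerProductSpace ℂ H] [CompleteSpace H]

/-- Measurability survives pointwise limits of sequences, and boundedness then gives integrability
because `μ` is finite. -/
theorem isClosed_bddSubmodule [IsFiniteMeasure μ] :
    IsClosed (bddSubmodule μ H : Set (Ω →ᵇ (H →L[ℂ] H))) := by
  refine IsSeqClosed.isClosed fun u f hu hf => ?_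
  have hpt (x : Ω) : Tendsto (fun n => u n x) atTop (𝓝 (f x)) :=
    (BoundedContinuousFunction.tendsto_iff_tendstoUniformly.1 hf).tendsto_at x
  have hm : AEStronglyMeasurable (fun x => f x) μ :=
    aestronglyMeasurable_of_tendsto_ae atTop (fun n => (hu n).2.aestronglyMeasurable)
      (ae_of_all _ hpt)
  refine ⟨fun x => ?_, Integrable.of_bound hm ‖f‖ (ae_of_all _ f.norm_coe_le_norm)⟩
  refine tendsto_nhds_unique ((hpt x).star.congr fun n => ?_) (hpt x)
  exact (hu n).1 x

instance [IsFiniteMeasure μ] : CompleteSpace (BddSpace μ H) :=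
  (isClosed_bddSubmodule (μ := μ) (H := H)).completeSpace_coe

/-- The functional `f ↦ re ⟪f x v, v⟫` for `p = (x, v)`. -/
noncomputable def evalForm (p : Ω × H) : BddSpace μ H →L[ℝ] ℝ :=
  LinearMap.mkContinuous
    { toFun := fun f => (f.1 p.1).reApplyInnerSelf p.2
      map_add' := fun f g => by
        change (f.1 p.1 + g.1 p.1).reApplyInnerSelf p.2 = _
        simp [ContinuousLinearMap.reApplyInnerSelf, inner_add_left]
      map_smul' := fun c f => by
        change (c • f.1 p.1).reApplyInnerSelf p.2 = _
        simp [ContinuousLinearMap.reApplyInnerSelf, inner_smul_left_eq_smul] }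
    (‖p.2‖ * ‖p.2‖) fun f => by
      refine (Complex.abs_re_le_norm _).trans ((norm_inner_le_norm _ _).trans ?_)
      calc _ ≤ ‖f.1‖ * ‖p.2‖ * ‖p.2‖ := by
            gcongr
            exact ContinuousLinearMap.le_of_opNorm_le _ (f.1.norm_coe_le_norm _) _
        _ = _ := by rw [mul_assoc, mul_comm]; rfl

theorem evalForm_apply (p : Ω × H) (f : BddSpace μ H) :
    evalForm p f = (f.1 p.1).reApplyInnerSelf p.2 := rfl

theorem isNonneg_iff (f : BddSpace μ H) : IsNonneg f ↔ ∀ p : Ω × H, 0 ≤ evalForm p f := by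
  simp only [IsNonneg, Prod.forall, evalForm_apply]
  refine forall_congr' fun x => ?_
  rw [ContinuousLinearMap.isPositive_def']
  exact and_iff_right (f.2.1 x)

theorem evalForm_idFun [IsFiniteMeasure μ] (p : Ω × H) :
    evalForm p (idFun μ H) = ‖p.2‖ ^ 2 := by
  change (1 : H →L[ℂ] H).reApplyInnerSelf p.2 = _
  rw [ContinuousLinearMap.reApplyInnerSelf]
  exact inner_self_eq_norm_sq _

theorem abs_evalForm_le (p : Ω × H) (f : BddSpace μ H) : |evalForm p f| ≤ ‖f‖ * ‖p.2‖ ^ 2 := by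
  have := (evalForm p).le_of_opNorm_le (LinearMap.mkContinuous_norm_le _ (by positivity) _) f
  rw [Real.norm_eq_abs] at this
  exact this.trans_eq (by ring)

/-- Each `f x` is self-adjoint, so its norm is the supremum of its absolute Rayleigh quotients. -/
theorem norm_le_of_abs_evalForm_le {f : BddSpace μ H} {c : ℝ} (hc : 0 ≤ c)
    (h : ∀ p : Ω × H, |evalForm p f| ≤ c * ‖p.2‖ ^ 2) : ‖f‖ ≤ c := by
  refine (BoundedContinuousFunction.norm_le hc).2 fun x => ?_
  change ‖f.1 x‖ ≤ c
  rw [(f.1 x).norm_eq_iSup_rayleighQuotient (f.2.1 x).isSymmetric]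
  refine ciSup_le fun v => ?_
  rw [ContinuousLinearMap.rayleighQuotient, abs_div, abs_sq]
  exact div_le_of_le_mul₀ (by positivity) hc (h (x, v))

/-- Positive operators that fix the identity are contractions. -/
theorem norm_apply_le_of_isNonneg [IsFiniteMeasure μ] {A : BddSpace μ H →ₗ[ℝ] BddSpace μ H}
    (h1 : A (idFun μ H) = idFun μ H) (hA : ∀ f, IsNonneg f → IsNonneg (A f)) (f : BddSpace μ H) :
    ‖A f‖ ≤ ‖f‖ := by
  refine norm_le_of_abs_evalForm_le (norm_nonneg _) fun p => ?_
  have hle (g : BddSpace μ H) (hg : ‖g‖ ≤ ‖f‖) :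
      evalForm p (A g) ≤ ‖f‖ * ‖p.2‖ ^ 2 := by
    have h2 : IsNonneg (‖f‖ • idFun μ H - g) := by
      refine (isNonneg_iff _).2 fun q => ?_
      rw [map_sub, map_smul, evalForm_idFun, smul_eq_mul, sub_nonneg]
      exact (le_abs_self _).trans ((abs_evalForm_le q g).trans (by gcongr))
    have h3 := (isNonneg_iff _).1 (hA _ h2) p
    rwa [map_sub, map_smul, h1, map_sub, map_smul, evalForm_idFun, smul_eq_mul,
      sub_nonneg] at h3
  refine abs_le'.2 ⟨hle f le_rfl, ?_⟩
  rw [← map_neg, ← map_neg]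
  -- The lower bound is the upper bound for `-f`, which has the same norm.
  exact hle (-f) (norm_neg f).le

/-! ### Passage between partial operators and their graphs. -/

theorem graph_mem (L : BddSpace μ H →ₗ.[ℝ] BddSpace μ H) {f g : BddSpace μ H} :
    (f, g) ∈ L.graph ↔ ∃ h : f ∈ L.domain, L ⟨f, h⟩ = g := by
  rw [LinearPMap.mem_graph_iff]
  constructor
  · rintro ⟨⟨y, hy⟩, rfl, h⟩
    exact ⟨hy, h⟩
  · rintro ⟨h, hg⟩
    exact ⟨⟨f, h⟩, rfl, hg⟩

theorem dense_domain_iff (L : BddSpace μ H →ₗ.[ℝ] BddSpace μ H) :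
    Dense (L.domain : Set (BddSpace μ H)) ↔ Dense {f | ∃ g, (f, g) ∈ (L.graph : Set (BddSpace μ H × BddSpace μ H))} := by
  suffices (L.domain : Set (BddSpace μ H)) = {f | ∃ g, (f, g) ∈ (L.graph : Set (BddSpace μ H × BddSpace μ H))} by rw [this]
  ext f
  simp

theorem isResolvent_iff (L : BddSpace μ H →ₗ.[ℝ] BddSpace μ H) (l : ℝ)
    (R : BddSpace μ H →L[ℝ] BddSpace μ H) :
    IsResolvent L l R ↔ IsGraphResolvent (L.graph : Set (BddSpace μ H × BddSpace μ H)) l R := by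
  constructor
  · refine fun h => ⟨fun g => ?_, fun f g hfg => ?_⟩
    · obtain ⟨hd, hg⟩ := h.right_inv g
      exact (graph_mem L).2 ⟨hd, by
        rw [eq_sub_iff_add_eq, add_comm, ← eq_sub_iff_add_eq]; exact hg.symm⟩
    · obtain ⟨hd, rfl⟩ := (graph_mem L).1 hfg
      exact h.left_inv ⟨f, hd⟩
  · refine fun h => ⟨fun g => ?_, fun f => h.left_inv _ _ (L.mem_graph f)⟩
    obtain ⟨hd, hg⟩ := (graph_mem L).1 (h.mem g)
    exact ⟨hd, by rw [hg]; abel⟩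

theorem isInfinitesimalGenerator_iff (T : ℝ≥0 → BddSpace μ H →L[ℝ] BddSpace μ H)
    (L : BddSpace μ H →ₗ.[ℝ] BddSpace μ H) :
    IsInfinitesimalGenerator (fun t => (T t).toLinearMap) L ↔
      {p | HasGenerator T p.1 p.2} = (L.graph : Set (BddSpace μ H × BddSpace μ H)) := by
  constructor
  · intro h
    ext ⟨f, g⟩
    refine Iff.trans ⟨fun hfg : HasGenerator T f g => ?_, ?_⟩ (graph_mem L).symm
    · have hd := (h.mem_domain_iff f).2 ⟨g, hfg⟩
      exact ⟨hd, tendsto_nhds_unique (h.tendsto ⟨f, hd⟩) hfg⟩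
    · rintro ⟨hd, rfl⟩
      exact h.tendsto ⟨f, hd⟩
  · intro h
    have hiff (f g) : HasGenerator T f g ↔ ∃ h : f ∈ L.domain, L ⟨f, h⟩ = g :=
      (Set.ext_iff.1 h (f, g)).trans (graph_mem L)
    refine ⟨fun f => ⟨fun hf => ⟨L ⟨f, hf⟩, (hiff _ _).2 ⟨hf, rfl⟩⟩, ?_⟩,
      fun f => (hiff _ _).2 ⟨f.2, rfl⟩⟩
    rintro ⟨g, hg⟩
    exact ((hiff f g).1 hg).1

theorem IsContractionSemigroup.isNonneg_laplace [IsFiniteMeasure μ]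
    {T : ℝ≥0 → BddSpace μ H →L[ℝ] BddSpace μ H} (hT : IsContractionSemigroup T)
    (hpos : ∀ t f, IsNonneg f → IsNonneg (T t f)) {l : ℝ} (hl : 0 < l) {f : BddSpace μ H}
    (hf : IsNonneg f) : IsNonneg (hT.laplace hl f) := by
  refine (isNonneg_iff _).2 fun p => ?_
  rw [hT.laplace_apply,
    ← ContinuousLinearMap.integral_comp_comm _ (hT.integrableOn_laplace hl f 0)]
  refine integral_nonneg fun t => ?_
  simp only [map_smul]
  exact mul_nonneg (Real.exp_pos _).le ((isNonneg_iff _).1 (hpos _ f hf) p)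

end Bdd

end MarkovHY

/-! ### The Hille–Yosida theorem for Markov semigroups. -/

theorem mainTheorem9 {Ω : Type*} [TopologicalSpace Ω] [MeasurableSpace Ω]
    (μ : MeasureTheory.Measure Ω) [MeasureTheory.IsProbabilityMeasure μ]
    (H : Type*) [NormedAddCommGroup H] [InnerProductSpace ℂ H] [CompleteSpace H]
    (L : MarkovHY.BddSpace μ H →ₗ.[ℝ] MarkovHY.BddSpace μ H) :
    (∃ P : ℝ≥0 → (MarkovHY.BddSpace μ H →ₗ[ℝ] MarkovHY.BddSpace μ H),
        MarkovHY.IsMarkovSemigroup P ∧ MarkovHY.IsInfinitesimalGenerator P L) ↔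
      (∃ h : MarkovHY.idFun μ H ∈ L.domain, L ⟨MarkovHY.idFun μ H, h⟩ = 0) ∧
      Dense (L.domain : Set (MarkovHY.BddSpace μ H)) ∧
      L.IsClosed ∧
      ∀ l : ℝ, 0 < l →
        ∃ R : MarkovHY.BddSpace μ H →L[ℝ] MarkovHY.BddSpace μ H,
          MarkovHY.IsResolvent L l R ∧ ‖R‖ ≤ 1 / l ∧
          ∀ f, MarkovHY.IsNonneg f → MarkovHY.IsNonneg (R f) := by
  constructor
  · rintro ⟨P, hP, hL⟩
    let T (t : ℝ≥0) : MarkovHY.BddSpace μ H →L[ℝ] MarkovHY.BddSpace μ H :=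
      (P t).mkContinuous 1 fun f => by
        simpa using MarkovHY.norm_apply_le_of_isNonneg (hP.mass t) (hP.positivity t) f
    have hT : MarkovHY.IsContractionSemigroup T :=
      ⟨fun f => congrArg (fun A => A f) hP.initial, fun s t f => by
        rw [add_comm]; exact (congrArg (fun A => A f) (hP.semigroup t s)).symm, hP.continuity,
        fun t => MarkovHY.norm_apply_le_of_isNonneg (hP.mass t) (hP.positivity t)⟩
    have hG := (MarkovHY.isInfinitesimalGenerator_iff T L).1 hL
    have hR (l : ℝ) (hl : 0 < l) : MarkovHY.IsGraphResolvent
        (L.graph : Set (MarkovHY.BddSpace μ H × MarkovHY.BddSpace μ H)) l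
        (hT.laplace hl) := hG ▸ hT.isGraphResolvent_laplace hl
    refine ⟨?_, ?_, (hR 1 one_pos).isClosed, fun l hl => ⟨hT.laplace hl,
      (MarkovHY.isResolvent_iff _ _ _).2 (hR l hl), hT.norm_laplace_le hl,
      fun f hf => hT.isNonneg_laplace hP.positivity hl hf⟩⟩
    · have h0 : MarkovHY.HasGenerator T (MarkovHY.idFun μ H) 0 := by
        refine tendsto_const_nhds.congr fun t => ?_
        have h1 : T t (MarkovHY.idFun μ H) = MarkovHY.idFun μ H := hP.mass t
        rw [h1, sub_self, smul_zero]
      exact (MarkovHY.graph_mem L).1 ((Set.ext_iff.1 hG (_, _)).1 h0)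
    · rw [MarkovHY.dense_domain_iff, ← hG]
      exact hT.dense_hasGenerator
  · rintro ⟨hI, hD, -, hR⟩
    obtain ⟨T, hT, hpos, hinc, hG⟩ := MarkovHY.exists_semigroup_of_resolvent
      (MarkovHY.evalForm (μ := μ) (H := H)) ((MarkovHY.dense_domain_iff L).1 hD) fun l hl => by
        simpa only [MarkovHY.isResolvent_iff, MarkovHY.isNonneg_iff] using hR l hl
    refine ⟨fun t => (T t).toLinearMap, ⟨?_, hT.continuous, fun s t => ?_, fun t => ?_, ?_⟩,
      (MarkovHY.isInfinitesimalGenerator_iff T L).2 hG⟩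
    · ext1 f
      exact hT.zero f
    · ext1 f
      rw [add_comm]
      exact (hT.add t s f).symm
    -- Since `L I = 0`, the increment bound reads `‖T t I - I‖ ≤ t * 0`.
    · have h0 := hinc _ _ ((MarkovHY.graph_mem L).2 hI) t
      rw [norm_zero, mul_zero, norm_le_zero_iff, sub_eq_zero] at h0
      exact h0
    · intro t f hf
      rw [MarkovHY.isNonneg_iff] at hf ⊢
      exact hpos t f hf
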